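/- For a function $u:\mathbb R\to\mathbb C$ let $$(-\Delta)^{1/2}u(x)=\frac1\pi\,\mathrm{p.v.}\!\int_{-\infty}^{\infty}\frac{u(x)-u(x+y)}{|y|^{2}}\,dy$$ (principal value at $y=0$). Fix $L>0$, and for $k\in\mathbb Z$ and $s\in(0,\pi)$ let $(-\Delta)_s^{1/2}e^{iks}$ denote the value at $x=L\cot s$ of $(-\Delta)^{1/2}$ applied to the function $x\mapsto e^{ik\,\mathrm{arccot}(x/L)}$, where $\mathrm{arccot}$ takes values in $(0,\pi)$. Let $M\ge 0$ be an integer, $a_0,\dots,a_M\in\mathbb C$, $s\in(0,\pi)$, and let $P$ be any integer with $P\ge 2M+1$. Let $\tilde b,\tilde c:\mathbb Z\to\mathbb C$ be the $P$-periodic sequences given by $$\tilde b_l=\begin{cases}(8l+4)a_l,&0\le l\le M,\\0,&M+1\le l\le P-1,\end{cases}\qquad \tilde c_l=\begin{cases}\frac13,&l=0,\\0,&1\le l\le P-M-1,\\ \dfrac1{(2(l-P)-3)(2(l-P)-1)(2(l-P)+1)},&P-M\le l\le P-1,\end{cases}$$ and let $(\tilde b*\tilde c)_l=\sum_{n=0}^{P-1}\tilde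 b_n\tilde c_{l-n}$ be their discrete cyclic convolution. Then the principal values defining $(-\Delta)_s^{1/2}e^{i(2l+1)s}$, $0\le l\le M$, exist, and $$\sum_{l=0}^{M}a_l(-\Delta)_s^{1/2}e^{i(2l+1)s}=-\frac{2i}{L\pi}\sum_{l=0}^{M}\frac{a_l}{2l+3}+\frac{2i}{L\pi}\sum_{l=0}^{M}(\tilde b*\tilde c)_l\,e^{2ils}-\frac{2i}{L\pi}\Big(\cos s+\sin^2 s\,\ln\cot\frac s2\Big)\sum_{l=0}^{M}(2l+1)a_l\,e^{i(2l+1)s}.$$ Moreover, with the discrete Fourier transform $\hat b_p=\sum_{l=0}^{P-1}b_l e^{-2\pi i lp/P}$ of $P$-periodic sequences, the convolution can be computed by discrete Fourier transforms of length $P$: $$(\tilde b*\tilde c)_l=\frac1P\sum_{p=0}^{P-1}\hat{\tilde b}_p\,\hat{\tilde c}_p\,e^{2\pi i lp/P},\qquad l\in\mathbb Z.$$ -/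

import Mathlib

open Filter Topology MeasureTheory

noncomputable section

namespace HalfLaplacian

/-- The normalizing constant
`c_α = α 2^(α-1) Γ(1/2 + α/2) / (√π Γ(1 - α/2))` of the one-dimensional fractional Laplacian. -/
def fracConst (α : ℝ) : ℝ :=
  α * (2 ^ (α - 1) * Real.Gamma (1 / 2 + α / 2)) / (Real.sqrt Real.pi * Real.Gamma (1 - α / 2))

/-- The integrand `(u(x) - u(x+y)) / |y|^(1+α)` as a function of `y`. -/
def fracIntegrand (α : ℝ) (u : ℝ → ℂ) (x y : ℝ) : ℂ :=
  (u x - u (x + y)) / ((|y| ^ (1 + α) : ℝ) : ℂ)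

/-- The fractional Laplacian at `x` with the symmetric neighbourhood `|y| ≤ ε` cut out. -/
def fracTruncated (α : ℝ) (u : ℝ → ℂ) (x ε : ℝ) : ℂ :=
  (fracConst α : ℂ) * ∫ y in {y : ℝ | ε < |y|}, fracIntegrand α u x y

/-- The principal value integral defining `(-Δ)^(α/2) u (x)` exists and has the value `v`. -/
def HasFracLaplacianAt (α : ℝ) (u : ℝ → ℂ) (x : ℝ) (v : ℂ) : Prop :=
  (∀ ε : ℝ, 0 < ε → IntegrableOn (fracIntegrand α u x) {y : ℝ | ε < |y|}) ∧
    Tendsto (fracTruncated α u x) (𝓝[>] 0) (𝓝 v)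

/-- The fractional Laplacian
`(-Δ)^(α/2) u (x) = c_α p.v. ∫ (u(x) - u(x+y)) / |y|^(1+α) dy` on `ℝ`
(meaningful when the principal value exists, see `HasFracLaplacianAt`). -/
def fracLaplacian (α : ℝ) (u : ℝ → ℂ) (x : ℝ) : ℂ :=
  limUnder (𝓝[>] 0) (fracTruncated α u x)

/-- The inverse cotangent with values in `(0, π)`. -/
def acot (x : ℝ) : ℝ := Real.pi / 2 - Real.arctan x

/-- A function of `s ∈ (0, π)`, seen as a function of `x ∈ ℝ` through `x = L cot s`. -/
def inX (L : ℝ) (f : ℝ → ℂ) (x : ℝ) : ℂ := f (acot (x / L))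

/-- `(-Δ)_s^(1/2) f (s)`: the half Laplacian in the variable `x = L cot s`. -/
def halfLaplacianS (L : ℝ) (f : ℝ → ℂ) (s : ℝ) : ℂ :=
  fracLaplacian 1 (inX L f) (L * Real.cot s)

/-- The principal value defining `(-Δ)_s^(1/2) f (s)` exists. -/
def HalfLaplacianSExists (L : ℝ) (f : ℝ → ℂ) (s : ℝ) : Prop :=
  HasFracLaplacianAt 1 (inX L f) (L * Real.cot s) (halfLaplacianS L f s)

/-- The function `s ↦ e^{iks}`. -/
def expMode (k : ℤ) (s : ℝ) : ℂ := Complex.exp (Complex.I * k * s)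

/-- The discrete cyclic convolution of two `P`-periodic sequences. -/
def cyclicConv (P : ℕ) (b c : ℤ → ℂ) (l : ℤ) : ℂ :=
  ∑ n ∈ Finset.range P, b n * c (l - n)

/-- The discrete Fourier transform of a `P`-periodic sequence. -/
def dft (P : ℕ) (b : ℤ → ℂ) (p : ℤ) : ℂ :=
  ∑ l ∈ Finset.range P, b l * Complex.exp (-(2 * Real.pi * Complex.I * l * p / P))

/-- The `P`-periodic extension of the values of `f` at `0, …, P - 1`. -/
def periodize (P : ℕ) (f : ℤ → ℂ) (l : ℤ) : ℂ := f (l % (P : ℤ))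

/-- The `P`-periodic sequence with `b̃_l = (8l+4) a_l` for `0 ≤ l ≤ M` and
`b̃_l = 0` for `M+1 ≤ l ≤ P-1`. -/
def bTilde (M P : ℕ) (a : ℕ → ℂ) : ℤ → ℂ :=
  periodize P fun l => if l ≤ M then (8 * (l : ℂ) + 4) * a l.toNat else 0

/-- The `P`-periodic sequence with `c̃_0 = 1/3`, `c̃_l = 0` for `1 ≤ l ≤ P-M-1` and
`c̃_l = 1 / ((2(l-P)-3) (2(l-P)-1) (2(l-P)+1))` for `P-M ≤ l ≤ P-1`. -/
def cTilde (M P : ℕ) : ℤ → ℂ :=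
  periodize P fun l =>
    if l = 0 then 1 / 3
    else if l ≤ (P : ℤ) - M - 1 then 0
    else 1 / ((2 * ((l : ℂ) - P) - 3) * (2 * ((l : ℂ) - P) - 1) * (2 * ((l : ℂ) - P) + 1))

end HalfLaplacian

end

/-!
Integrating by parts, the half Laplacian of a bounded function `u` is the Hilbert transform of `u'`.
Under `x = L cot s` it becomes `sin s / (Lπ) · p.v. ∫₀^π f'(t) sin t / sin (s - t) dt`. For
`f(t) = e^{i(2n+1)t}`, subtracting the polar part `f'(s) sin s / sin (s - t)` leaves a trigonometric
polynomial in `t`, a geometric sum in `e^{2it}` and `e^{2is}`, while the polar part contributes the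
logarithm. Multiplying the integrated geometric sum by `sin s` and rearranging by powers of `e^{is}`
turns its coefficients `1/(2m+1)` into their second differences `8 / ((2m-3)(2m-1)(2m+1))`.

These coefficients depend only on `l - n`, so summing over the modes is a convolution, and
`P ≥ 2M + 1` prevents the cyclic convolution from wrapping around.
-/

namespace HalfLaplacian

open Complex
open scoped Real

section PrincipalValue

theorem setOf_lt_abs_eq_Iio_union_Ioi {G : Type*} [AddCommGroup G] [LinearOrder G]
    [IsOrderedAddMonoid G] (a : G) : {y : G | a < |y|} = Set.Iio (-a) ∪ Set.Ioi a := by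
  ext y
  simp only [Set.mem_ofPred_eq, lt_abs, Set.mem_union, Set.mem_Iio, Set.mem_Ioi, lt_neg, or_comm]

theorem integrableOn_abs_rpow {r ε : ℝ} (hr : r < -1) (hε : 0 < ε) :
    IntegrableOn (fun y : ℝ => |y| ^ r) {y | ε < |y|} := by
  have hIoi : IntegrableOn (fun y : ℝ => |y| ^ r) (Set.Ioi ε) :=
    (integrableOn_Ioi_rpow_of_lt hr hε).congr_fun
      (fun y (hy : ε < y) => by simp only [abs_of_pos (hε.trans hy)]) measurableSet_Ioi
  have hIio : IntegrableOn (fun y : ℝ => |y| ^ r) (Set.Iio (-ε)) := by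
    have h := hIoi
    rw [← neg_neg ε] at h
    simpa only [abs_neg] using h.comp_neg_Iio
  rw [setOf_lt_abs_eq_Iio_union_Ioi]
  exact hIio.union hIoi

theorem integrableOn_fracIntegrand {α : ℝ} (hα : 0 < α) {u : ℝ → ℂ} (hu : Measurable u) {C : ℝ}
    (hC : ∀ x, ‖u x‖ ≤ C) (x : ℝ) {ε : ℝ} (hε : 0 < ε) :
    IntegrableOn (fracIntegrand α u x) {y | ε < |y|} := by
  have hbound : IntegrableOn (fun y : ℝ => (C + C) * |y| ^ (-(1 + α))) {y | ε < |y|} :=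
    (integrableOn_abs_rpow (by linarith) hε).const_mul _
  refine hbound.mono' ?_ (Eventually.of_forall fun y => ?_)
  · have : Measurable (fracIntegrand α u x) := by
      unfold fracIntegrand
      fun_prop
    exact this.aestronglyMeasurable
  · rw [fracIntegrand, norm_div, norm_real, Real.norm_of_nonneg (by positivity),
      Real.rpow_neg (abs_nonneg y), div_eq_mul_inv]
    gcongr
    exact norm_sub_le_of_le (hC x) (hC (x + y))

theorem fracConst_one : fracConst 1 = 1 / π := by
  have h : (1 : ℝ) - 1 / 2 = 1 / 2 := by norm_num
  rw [fracConst, h, Real.Gamma_one_half_eq, Real.mul_self_sqrt Real.pi_pos.le]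
  norm_num

theorem fracIntegrand_one (u : ℝ → ℂ) (x y : ℝ) :
    fracIntegrand 1 u x y = (u x - u (x + y)) / (y : ℂ) ^ 2 := by
  rw [fracIntegrand, one_add_one_eq_two, Real.rpow_two, sq_abs, ofReal_pow]

theorem fracTruncated_one_eq_of_hasDerivAt {u G : ℝ → ℂ} {x ε : ℝ} (hε : 0 < ε) {A B : ℂ}
    (hint : IntegrableOn (fracIntegrand 1 u x) {y | ε < |y|})
    (hG : ∀ y ≠ 0, HasDerivAt G (fracIntegrand 1 u x y) y)
    (htop : Tendsto G atTop (𝓝 A)) (hbot : Tendsto G atBot (𝓝 B)) :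
    fracTruncated 1 u x ε = 1 / π * (A - B + (G (-ε) - G ε)) := by
  rw [setOf_lt_abs_eq_Iio_union_Ioi] at hint
  have hleft := hint.left_of_union
  have hright := hint.right_of_union
  have integral_Ioi := integral_Ioi_of_hasDerivAt_of_tendsto
    (hG ε hε.ne').continuousAt.continuousWithinAt (fun y hy => hG y (hε.trans hy).ne') hright htop
  have integral_Iic := integral_Iic_of_hasDerivAt_of_tendsto
    (hG (-ε) (neg_ne_zero.2 hε.ne')).continuousAt.continuousWithinAt
    (fun y (hy : y < -ε) => hG y (hy.trans (neg_lt_zero.2 hε)).ne)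
    ((integrableOn_Iic_iff_integrableOn_Iio (by finiteness)).2 hleft) hbot
  have hdisj : Disjoint (Set.Iio (-ε)) (Set.Ioi ε) :=
    Set.Iio_disjoint_Ioi_of_le (neg_lt_self hε).le
  rw [fracTruncated, fracConst_one, setOf_lt_abs_eq_Iio_union_Ioi,
    setIntegral_union hdisj measurableSet_Ioi hleft hright, ← integral_Iic_eq_integral_Iio,
    integral_Iic, integral_Ioi]
  push_cast
  ring

theorem tendsto_sub_div_of_norm_le {u : ℝ → ℂ} {C : ℝ} (hC : ∀ x, ‖u x‖ ≤ C) (x : ℝ)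
    {F : Filter ℝ} (hF : Tendsto (fun y : ℝ => |y|) F atTop) :
    Tendsto (fun y : ℝ => (u (x + y) - u x) / (y : ℂ)) F (𝓝 0) := by
  have hbound : Tendsto (fun y : ℝ => (C + C) * |y|⁻¹) F (𝓝 0) := by
    simpa only [mul_zero, Function.comp_apply] using
      (tendsto_inv_atTop_zero.comp hF).const_mul (C + C)
  refine squeeze_zero_norm (fun y => ?_) hbound
  rw [norm_div, norm_real, Real.norm_eq_abs, div_eq_mul_inv]
  gcongr
  exact norm_sub_le_of_le (hC (x + y)) (hC x)

theorem tendsto_symm_slope_sub_slope {u : ℝ → ℂ} {u' : ℂ} {x : ℝ} (hu : HasDerivAt u u' x) :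
    Tendsto (fun ε : ℝ => (u (x + -ε) - u x) / ((-ε : ℝ) : ℂ) - (u (x + ε) - u x) / (ε : ℂ))
      (𝓝[>] 0) (𝓝 0) := by
  have hneg : Tendsto (fun ε : ℝ => -ε) (𝓝[>] 0) (𝓝[<] 0) := by
    simpa only [neg_zero] using tendsto_neg_nhdsGT (a := (0 : ℝ))
  have h := (hu.tendsto_slope_zero_left.comp hneg).sub hu.tendsto_slope_zero_right
  rw [sub_self] at h
  refine h.congr fun ε => ?_
  simp only [Function.comp_apply, real_smul, ofReal_inv, div_eq_inv_mul]

/-- Integrating by parts, `(u(x) - u(x+y)) / y² = d/dy [(u(x+y) - u(x)) / y] - u'(x+y) / y`, so that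
the half Laplacian is the Hilbert transform of `u'`. -/
theorem hasFracLaplacianAt_one_of_hasDerivAt_div {u u' H : ℝ → ℂ} {x C : ℝ} {A B : ℂ}
    (hu : ∀ y, HasDerivAt u (u' y) y) (hC : ∀ y, ‖u y‖ ≤ C)
    (hH : ∀ y ≠ 0, HasDerivAt H (u' (x + y) / y) y)
    (htop : Tendsto H atTop (𝓝 A)) (hbot : Tendsto H atBot (𝓝 B))
    (hzero : Tendsto (fun ε => H ε - H (-ε)) (𝓝[>] 0) (𝓝 0)) :
    HasFracLaplacianAt 1 u x ((B - A) / π) := by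
  have hcont : Continuous u := continuous_iff_continuousAt.2 fun y => (hu y).continuousAt
  have hint {ε : ℝ} (hε : 0 < ε) := integrableOn_fracIntegrand one_pos hcont.measurable hC x hε
  refine ⟨fun ε hε => hint hε, ?_⟩
  set G : ℝ → ℂ := fun y => (u (x + y) - u x) / y - H y with hG
  have hGderiv (y : ℝ) (hy : y ≠ 0) : HasDerivAt G (fracIntegrand 1 u x y) y := by
    have hy' : (y : ℂ) ≠ 0 := ofReal_ne_zero.2 hy
    have hquot := (((hu (x + y)).comp_const_add x y).sub_const (u x)).div
      (hasDerivAt_id y).ofReal_comp hy'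
    refine (hquot.sub (hH y hy)).congr_deriv ?_
    rw [fracIntegrand_one]
    simp only [id_eq, ofReal_one]
    field_simp
    ring
  have hGtop : Tendsto G atTop (𝓝 (0 - A)) :=
    (tendsto_sub_div_of_norm_le hC x tendsto_abs_atTop_atTop).sub htop
  have hGbot : Tendsto G atBot (𝓝 (0 - B)) :=
    (tendsto_sub_div_of_norm_le hC x tendsto_abs_atBot_atTop).sub hbot
  have hGzero : Tendsto (fun ε => G (-ε) - G ε) (𝓝[>] 0) (𝓝 0) := by
    have h := (tendsto_symm_slope_sub_slope (hu x)).add hzero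
    rw [add_zero] at h
    refine h.congr fun ε => ?_
    simp only [hG]
    ring
  have hlim := (hGzero.const_add (0 - A - (0 - B))).const_mul (1 / (π : ℂ))
  rw [show 1 / (π : ℂ) * (0 - A - (0 - B) + 0) = (B - A) / π by ring] at hlim
  refine hlim.congr' ?_
  filter_upwards [self_mem_nhdsWithin] with ε (hε : 0 < ε)
  exact (fracTruncated_one_eq_of_hasDerivAt hε (hint hε) hGderiv hGtop hGbot).symm

theorem HasFracLaplacianAt.fracLaplacian_eq {α : ℝ} {u : ℝ → ℂ} {x : ℝ} {v : ℂ}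
    (h : HasFracLaplacianAt α u x v) : fracLaplacian α u x = v :=
  h.2.limUnder_eq

end PrincipalValue

section Arccotangent

theorem acot_mem_Ioo (v : ℝ) : acot v ∈ Set.Ioo 0 π := by
  rw [acot]
  constructor <;> linarith [Real.arctan_lt_pi_div_two v, Real.neg_pi_div_two_lt_arctan v]

theorem sin_acot_pos (v : ℝ) : 0 < Real.sin (acot v) :=
  Real.sin_pos_of_mem_Ioo (acot_mem_Ioo v)

theorem cos_acot (v : ℝ) : Real.cos (acot v) = v * Real.sin (acot v) := by
  rw [acot, Real.cos_pi_div_two_sub, Real.sin_pi_div_two_sub]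
  nth_rewrite 2 [← Real.tan_arctan v]
  rw [Real.tan_mul_cos (Real.cos_arctan_pos v).ne']

theorem hasDerivAt_acot (v : ℝ) : HasDerivAt acot (-Real.sin (acot v) ^ 2) v := by
  rw [acot, Real.sin_pi_div_two_sub, Real.cos_sq_arctan]
  exact (Real.hasDerivAt_arctan v).const_sub _

theorem acot_cot {s : ℝ} (hs : s ∈ Set.Ioo 0 π) : acot (Real.cot s) = s := by
  rw [acot, ← Real.tan_inv_eq_cot, ← Real.tan_pi_div_two_sub, Real.arctan_tan] <;>
    linarith [hs.1, hs.2]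

theorem tendsto_acot_atTop : Tendsto acot atTop (𝓝[>] 0) := by
  have h := (Real.tendsto_arctan_atTop.mono_right nhdsWithin_le_nhds).const_sub (π / 2)
  rw [sub_self] at h
  exact tendsto_nhdsWithin_iff.2 ⟨h, Eventually.of_forall fun v => (acot_mem_Ioo v).1⟩

theorem tendsto_acot_atBot : Tendsto acot atBot (𝓝[<] π) := by
  have h := (Real.tendsto_arctan_atBot.mono_right nhdsWithin_le_nhds).const_sub (π / 2)
  rw [sub_neg_eq_add, add_halves] at h
  exact tendsto_nhdsWithin_iff.2 ⟨h, Eventually.of_forall fun v => (acot_mem_Ioo v).2⟩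

theorem sin_sub_acot {s : ℝ} (hs : Real.sin s ≠ 0) (v : ℝ) :
    Real.sin (s - acot v) = (v - Real.cot s) * (Real.sin s * Real.sin (acot v)) := by
  rw [Real.sin_sub, cos_acot, Real.cot_eq_cos_div_sin]
  field_simp

/-- The angle `t ∈ (0, π)` of the point `L cot t = L cot s + y`: the substitution that turns
integrals over the real line into integrals over `(0, π)`. -/
noncomputable def shiftedAngle (L s y : ℝ) : ℝ := acot (Real.cot s + y / L)

theorem acot_add_div {L : ℝ} (hL : L ≠ 0) (s y : ℝ) :
    acot ((L * Real.cot s + y) / L) = shiftedAngle L s y := by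
  rw [shiftedAngle, add_div, mul_div_cancel_left₀ _ hL]

theorem shiftedAngle_mem_Ioo (L s y : ℝ) : shiftedAngle L s y ∈ Set.Ioo 0 π :=
  acot_mem_Ioo _

theorem shiftedAngle_zero (L : ℝ) {s : ℝ} (hs : s ∈ Set.Ioo 0 π) : shiftedAngle L s 0 = s := by
  rw [shiftedAngle, zero_div, add_zero, acot_cot hs]

theorem hasDerivAt_shiftedAngle (L s y : ℝ) :
    HasDerivAt (shiftedAngle L s) (-Real.sin (shiftedAngle L s y) ^ 2 / L) y := by
  have h : HasDerivAt (fun y : ℝ => Real.cot s + y / L) (1 / L) y :=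
    ((hasDerivAt_id y).div_const L).const_add _
  exact ((hasDerivAt_acot _).comp y h).congr_deriv (by rw [mul_one_div]; rfl)

theorem continuous_shiftedAngle (L s : ℝ) : Continuous (shiftedAngle L s) :=
  continuous_iff_continuousAt.2 fun y => (hasDerivAt_shiftedAngle L s y).continuousAt

theorem sin_sub_shiftedAngle (L : ℝ) {s : ℝ} (hs : Real.sin s ≠ 0) (y : ℝ) :
    Real.sin (s - shiftedAngle L s y) =
      y / L * (Real.sin s * Real.sin (shiftedAngle L s y)) := by
  rw [shiftedAngle, sin_sub_acot hs, add_sub_cancel_left]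

theorem shiftedAngle_ne {L : ℝ} (hL : L ≠ 0) {s : ℝ} (hs : Real.sin s ≠ 0) {y : ℝ} (hy : y ≠ 0) :
    shiftedAngle L s y ≠ s := by
  intro h
  have hsin := sin_sub_shiftedAngle L hs y
  rw [h, sub_self, Real.sin_zero] at hsin
  exact (mul_ne_zero (div_ne_zero hy hL) (mul_ne_zero hs hs)) hsin.symm

theorem tendsto_shiftedAngle_atTop {L : ℝ} (hL : 0 < L) (s : ℝ) :
    Tendsto (shiftedAngle L s) atTop (𝓝[>] 0) :=
  tendsto_acot_atTop.comp (tendsto_atTop_add_const_left _ _ (tendsto_id.atTop_div_const hL))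

theorem tendsto_shiftedAngle_atBot {L : ℝ} (hL : 0 < L) (s : ℝ) :
    Tendsto (shiftedAngle L s) atBot (𝓝[<] π) :=
  tendsto_acot_atBot.comp (tendsto_atBot_add_const_left _ _ (tendsto_id.atBot_div_const hL))

end Arccotangent

section ChangeOfVariables

theorem hasDerivAt_inX {f : ℝ → ℂ} {L x : ℝ} {f' : ℂ} (hf : HasDerivAt f f' (acot (x / L))) :
    HasDerivAt (inX L f) (-(Real.sin (acot (x / L)) ^ 2 / L * f')) x := by
  have h : HasDerivAt (fun x : ℝ => acot (x / L)) (-Real.sin (acot (x / L)) ^ 2 * (1 / L)) x :=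
    (hasDerivAt_acot _).comp x ((hasDerivAt_id x).div_const L)
  refine (hf.scomp x h).congr_deriv ?_
  rw [real_smul]
  push_cast
  ring

theorem hasFracLaplacianAt_one_inX_of_hasDerivAt {L : ℝ} (hL : 0 < L) {s : ℝ}
    (hs : s ∈ Set.Ioo 0 π) {f f' Q : ℝ → ℂ} {C : ℝ} {A B : ℂ}
    (hf : ∀ t ∈ Set.Ioo 0 π, HasDerivAt f (f' t) t) (hC : ∀ t ∈ Set.Ioo 0 π, ‖f t‖ ≤ C)
    (hQ : ∀ t ∈ Set.Ioo 0 π, t ≠ s →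
      HasDerivAt Q (f' t * Complex.sin t / Complex.sin (s - t)) t)
    (hA : Tendsto Q (𝓝[>] 0) (𝓝 A)) (hB : Tendsto Q (𝓝[<] π) (𝓝 B))
    (hpv : Tendsto (fun ε => Q (shiftedAngle L s ε) - Q (shiftedAngle L s (-ε)))
      (𝓝[>] 0) (𝓝 0)) :
    HasFracLaplacianAt 1 (inX L f) (L * Real.cot s) (Complex.sin s / (L * π) * (B - A)) := by
  have hL' : (L : ℂ) ≠ 0 := ofReal_ne_zero.2 hL.ne'
  have hsin : Real.sin s ≠ 0 := (Real.sin_pos_of_mem_Ioo hs).ne'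
  set κ : ℂ := Complex.sin s / L with hκ
  set T : ℝ → ℝ := shiftedAngle L s with hT
  have hu (x : ℝ) := hasDerivAt_inX (hf _ (acot_mem_Ioo (x / L)))
  have hH (y : ℝ) (hy : y ≠ 0) : HasDerivAt (fun y => κ * Q (T y))
      (-(Real.sin (acot ((L * Real.cot s + y) / L)) ^ 2 / L *
        f' (acot ((L * Real.cot s + y) / L))) / y) y := by
    have hTy := shiftedAngle_mem_Ioo L s y
    have hQT := ((hQ _ hTy (shiftedAngle_ne hL.ne' hsin hy)).scomp y
      (hasDerivAt_shiftedAngle L s y)).const_mul κ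
    have hsub : Complex.sin (s - T y) = y / L * (Complex.sin s * Complex.sin (T y)) := by
      exact_mod_cast sin_sub_shiftedAngle L hsin y
    have hsin' : Complex.sin s ≠ 0 := by exact_mod_cast hsin
    have hsinT : Complex.sin (T y) ≠ 0 := by exact_mod_cast (sin_acot_pos _).ne'
    have hy' : (y : ℂ) ≠ 0 := ofReal_ne_zero.2 hy
    refine hQT.congr_deriv ?_
    rw [acot_add_div hL.ne', real_smul, ← hT, hsub, hκ]
    push_cast
    field_simp
  have htop : Tendsto (fun y => κ * Q (T y)) atTop (𝓝 (κ * A)) :=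
    (hA.comp (tendsto_shiftedAngle_atTop hL s)).const_mul κ
  have hbot : Tendsto (fun y => κ * Q (T y)) atBot (𝓝 (κ * B)) :=
    (hB.comp (tendsto_shiftedAngle_atBot hL s)).const_mul κ
  have hzero : Tendsto (fun ε => κ * Q (T ε) - κ * Q (T (-ε))) (𝓝[>] 0) (𝓝 0) := by
    simpa only [mul_sub, mul_zero] using hpv.const_mul κ
  convert hasFracLaplacianAt_one_of_hasDerivAt_div (C := C) hu
    (fun x => hC _ (acot_mem_Ioo (x / L))) hH htop hbot hzero using 1
  rw [hκ]
  ring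

end ChangeOfVariables

section LogarithmicSingularity

/-- `Real.log x` is `log |x|`, so this is a primitive of `-1 / sin (s - t)` on both sides of `s`. -/
theorem hasDerivAt_log_tan_half {s t : ℝ} (hst : Real.sin (s - t) ≠ 0) :
    HasDerivAt (fun t : ℝ => Real.log (Real.tan ((s - t) / 2))) (-1 / Real.sin (s - t)) t := by
  have hdouble : Real.sin (s - t) = 2 * Real.sin ((s - t) / 2) * Real.cos ((s - t) / 2) := by
    rw [← Real.sin_two_mul, mul_div_cancel₀ _ two_ne_zero]
  rw [hdouble] at hst ⊢
  have hcos := right_ne_zero_of_mul hst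
  have hsin := right_ne_zero_of_mul (left_ne_zero_of_mul hst)
  have htan : Real.tan ((s - t) / 2) ≠ 0 := by
    rw [Real.tan_eq_sin_div_cos]
    exact div_ne_zero hsin hcos
  have hhalf : HasDerivAt (fun t : ℝ => (s - t) / 2) (-1 / 2) t :=
    ((hasDerivAt_id t).const_sub s).div_const 2
  refine (((Real.hasDerivAt_tan hcos).comp t hhalf).log (by exact htan)).congr_deriv ?_
  simp only [Function.comp_apply, Real.tan_eq_sin_div_cos]
  field_simp

theorem sin_sub_ne_zero {s t : ℝ} (hs : s ∈ Set.Ioo 0 π) (ht : t ∈ Set.Icc 0 π) (hts : t ≠ s) :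
    Real.sin (s - t) ≠ 0 := by
  rw [Ne, Real.sin_eq_zero_iff_of_lt_of_lt (by linarith [hs.1, ht.2]) (by linarith [hs.2, ht.1]),
    sub_eq_zero]
  exact hts.symm

theorem log_tan_half (s : ℝ) : Real.log (Real.tan (s / 2)) = -Real.log (Real.cot (s / 2)) := by
  rw [← Real.tan_inv_eq_cot, Real.log_inv, neg_neg]

theorem log_tan_half_sub_pi (s : ℝ) :
    Real.log (Real.tan ((s - π) / 2)) = Real.log (Real.cot (s / 2)) := by
  rw [show (s - π) / 2 = -(π / 2 - s / 2) by ring, Real.tan_neg, Real.log_neg_eq_log,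
    Real.tan_pi_div_two_sub, Real.tan_inv_eq_cot]

theorem tendsto_log_add_sub_log_sub {τ : ℝ → ℝ} {τ' x : ℝ} (hτ : HasDerivAt τ τ' x)
    (hx : τ x = 0) (hτ' : τ' ≠ 0) :
    Tendsto (fun ε : ℝ => Real.log (τ (x + ε)) - Real.log (τ (x - ε))) (𝓝[>] 0) (𝓝 0) := by
  have hneg : Tendsto (fun ε : ℝ => -ε) (𝓝[>] 0) (𝓝[<] 0) := by
    simpa only [neg_zero] using tendsto_neg_nhdsGT (a := (0 : ℝ))
  have hright := hτ.tendsto_slope_zero_right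
  have hleft := hτ.tendsto_slope_zero_left.comp hneg
  have hlog := (hright.log hτ').sub (hleft.log hτ')
  rw [sub_self] at hlog
  refine hlog.congr' ?_
  filter_upwards [hright.eventually_ne hτ', hleft.eventually_ne hτ', self_mem_nhdsWithin]
    with ε hrightε hleftε (hε : 0 < ε)
  simp only [hx, sub_zero, smul_eq_mul, Function.comp_apply, ← sub_eq_add_neg] at hrightε hleftε ⊢
  rw [Real.log_mul (inv_ne_zero hε.ne') (right_ne_zero_of_mul hrightε),
    Real.log_mul (inv_ne_zero (neg_ne_zero.2 hε.ne')) (right_ne_zero_of_mul hleftε),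
    Real.log_inv, Real.log_inv, Real.log_neg_eq_log]
  ring

theorem tendsto_log_tan_half_shiftedAngle {L : ℝ} (hL : L ≠ 0) {s : ℝ} (hs : s ∈ Set.Ioo 0 π) :
    Tendsto (fun ε => Real.log (Real.tan ((s - shiftedAngle L s ε) / 2)) -
      Real.log (Real.tan ((s - shiftedAngle L s (-ε)) / 2))) (𝓝[>] 0) (𝓝 0) := by
  have hzero : (s - shiftedAngle L s 0) / 2 = 0 := by
    rw [shiftedAngle_zero L hs, sub_self, zero_div]
  have hcos : Real.cos ((s - shiftedAngle L s 0) / 2) ≠ 0 := by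
    rw [hzero, Real.cos_zero]
    exact one_ne_zero
  have htan := (Real.hasDerivAt_tan hcos).comp 0
    (((hasDerivAt_shiftedAngle L s 0).const_sub s).div_const 2)
  have hslope : 1 / Real.cos ((s - shiftedAngle L s 0) / 2) ^ 2 *
      (-(-Real.sin (shiftedAngle L s 0) ^ 2 / L) / 2) ≠ 0 := by
    have hsin : Real.sin s ≠ 0 := (Real.sin_pos_of_mem_Ioo hs).ne'
    have heq : 1 / (1 : ℝ) ^ 2 * (-(-Real.sin s ^ 2 / L) / 2) = Real.sin s ^ 2 / L / 2 := by ring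
    rw [hzero, Real.cos_zero, shiftedAngle_zero L hs, heq]
    positivity
  simpa only [zero_add, zero_sub, Function.comp_apply] using
    tendsto_log_add_sub_log_sub htan (by simp only [Function.comp_apply, hzero, Real.tan_zero])
      hslope

theorem tendsto_sub_log_tan_half_shiftedAngle {L : ℝ} (hL : L ≠ 0) {s : ℝ} (hs : s ∈ Set.Ioo 0 π)
    {R : ℝ → ℂ} (hR : Continuous R) (c : ℂ) :
    Tendsto (fun ε =>
      R (shiftedAngle L s ε) - c * Real.log (Real.tan ((s - shiftedAngle L s ε) / 2)) -
        (R (shiftedAngle L s (-ε)) - c * Real.log (Real.tan ((s - shiftedAngle L s (-ε)) / 2))))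
      (𝓝[>] 0) (𝓝 0) := by
  have hregular : Tendsto (fun ε => R (shiftedAngle L s ε) - R (shiftedAngle L s (-ε)))
      (𝓝[>] 0) (𝓝 0) := by
    have hT := continuous_shiftedAngle L s
    have hcont : Continuous fun ε => R (shiftedAngle L s ε) - R (shiftedAngle L s (-ε)) := by
      fun_prop
    simpa only [neg_zero, sub_self] using (hcont.tendsto 0).mono_left nhdsWithin_le_nhds
  have hlog := (tendsto_ofReal_iff.2 (tendsto_log_tan_half_shiftedAngle hL hs)).const_mul c
  have h := hregular.sub hlog
  rw [ofReal_zero, mul_zero, sub_zero] at h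
  refine h.congr fun ε => ?_
  push_cast
  ring

/-- The hypothesis on `R` says that `f'(t) sin t / sin (s - t)` exceeds its polar part
`f'(s) sin s / sin (s - t)` by the regular function `R'`. -/
theorem hasFracLaplacianAt_one_inX_of_regularPart {L : ℝ} (hL : 0 < L) {s : ℝ}
    (hs : s ∈ Set.Ioo 0 π) {f f' R R' : ℝ → ℂ} {C : ℝ}
    (hf : ∀ t ∈ Set.Ioo 0 π, HasDerivAt f (f' t) t) (hC : ∀ t ∈ Set.Ioo 0 π, ‖f t‖ ≤ C)
    (hRcont : Continuous R) (hR : ∀ t ∈ Set.Ioo 0 π, HasDerivAt R (R' t) t)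
    (hR' : ∀ t ∈ Set.Ioo 0 π,
      R' t * Complex.sin (s - t) = f' t * Complex.sin t - f' s * Complex.sin s) :
    HasFracLaplacianAt 1 (inX L f) (L * Real.cot s)
      (Complex.sin s / (L * π) *
        (R π - R 0 - 2 * f' s * Complex.sin s * Real.log (Real.cot (s / 2)))) := by
  set c : ℂ := f' s * Complex.sin s with hc
  set ℓ : ℝ → ℝ := fun t => Real.log (Real.tan ((s - t) / 2)) with hℓ
  have hℓderiv {t : ℝ} (ht : t ∈ Set.Icc 0 π) (hts : t ≠ s) :
      HasDerivAt ℓ (-1 / Real.sin (s - t)) t :=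
    hasDerivAt_log_tan_half (sin_sub_ne_zero hs ht hts)
  have hQ (t : ℝ) (ht : t ∈ Set.Ioo 0 π) (hts : t ≠ s) :
      HasDerivAt (fun t => R t - c * ℓ t) (f' t * Complex.sin t / Complex.sin (s - t)) t := by
    have ht' := Set.Ioo_subset_Icc_self ht
    have hsin : Complex.sin (s - t) ≠ 0 := by exact_mod_cast sin_sub_ne_zero hs ht' hts
    refine ((hR t ht).sub ((hℓderiv ht' hts).ofReal_comp.const_mul c)).congr_deriv ?_
    push_cast
    field_simp
    linear_combination hR' t ht
  have hQlim {t : ℝ} (ht : t ∈ Set.Icc 0 π) (hts : t ≠ s) :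
      Tendsto (fun t => R t - c * ℓ t) (𝓝 t) (𝓝 (R t - c * ℓ t)) :=
    (hRcont.tendsto t).sub ((hℓderiv ht hts).ofReal_comp.continuousAt.tendsto.const_mul c)
  have hA := (hQlim ⟨le_rfl, Real.pi_pos.le⟩ hs.1.ne).mono_left
    (nhdsWithin_le_nhds (s := Set.Ioi 0))
  have hB := (hQlim ⟨Real.pi_pos.le, le_rfl⟩ hs.2.ne').mono_left
    (nhdsWithin_le_nhds (s := Set.Iio π))
  have hpv := tendsto_sub_log_tan_half_shiftedAngle hL.ne' hs hRcont c
  convert hasFracLaplacianAt_one_inX_of_hasDerivAt hL hs hf hC hQ hA hB hpv using 2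
  simp only [hℓ]
  rw [sub_zero, log_tan_half_sub_pi, log_tan_half, hc]
  push_cast
  ring

end LogarithmicSingularity

section OddModes

theorem expMode_natCast (n : ℕ) (t : ℝ) : expMode n t = exp (I * t) ^ n := by
  rw [expMode, ← exp_nat_mul, Int.cast_natCast, mul_left_comm, mul_assoc]

theorem hasDerivAt_expMode (k : ℤ) (t : ℝ) : HasDerivAt (expMode k) (I * k * expMode k t) t := by
  have h : HasDerivAt (fun z : ℂ => exp (I * k * z)) (exp (I * k * t) * (I * k)) t := by
    simpa only [mul_one, id_eq] using ((hasDerivAt_id (t : ℂ)).const_mul (I * k)).cexp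
  exact h.comp_ofReal.congr_deriv (mul_comm _ _)

theorem norm_expMode (k : ℤ) (t : ℝ) : ‖expMode k t‖ = 1 := by
  rw [expMode, show I * k * t = ((k * t : ℝ) : ℂ) * I by push_cast; ring, norm_exp_ofReal_mul_I]

theorem two_I_mul_exp_mul_exp_mul_sin_sub (x y : ℂ) :
    2 * I * exp (I * x) * exp (I * y) * Complex.sin (x - y) =
      exp (I * x) ^ 2 - exp (I * y) ^ 2 := by
  have hsin := Complex.two_sin (x - y)
  have hx : exp (I * x) * exp (I * y) * exp ((x - y) * I) = exp (I * x) ^ 2 := by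
    rw [← exp_add, ← exp_add, ← exp_nat_mul]
    ring_nf
  have hy : exp (I * x) * exp (I * y) * exp (-(x - y) * I) = exp (I * y) ^ 2 := by
    rw [← exp_add, ← exp_add, ← exp_nat_mul]
    ring_nf
  linear_combination I * exp (I * x) * exp (I * y) * hsin + hx - hy +
    exp (I * x) * exp (I * y) * (exp (-(x - y) * I) - exp ((x - y) * I)) * I_sq

theorem two_I_mul_exp_mul_sin (x : ℂ) :
    2 * I * exp (I * x) * Complex.sin x = exp (I * x) ^ 2 - 1 := by
  simpa using two_I_mul_exp_mul_exp_mul_sin_sub x 0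

/-- The primitive in `z` of `w (w^{2n} - z^{2n}) / (w² - z²)` that is odd in `z`. With `w = e^{is}`
and `z = e^{it}` it integrates `e^{2int} / sin (s - t)` up to the pole at `t = s`. -/
def oddPrimitive {K : Type*} [Field K] (n : ℕ) (w z : K) : K :=
  w * ∑ j ∈ Finset.range n, z ^ (2 * j + 1) / (2 * j + 1) * (w ^ 2) ^ (n - 1 - j)

theorem oddPrimitive_neg {K : Type*} [Field K] (n : ℕ) (w z : K) :
    oddPrimitive n w (-z) = -oddPrimitive n w z := by
  simp only [oddPrimitive, Odd.neg_pow (odd_two_mul_add_one _), neg_div, neg_mul,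
    Finset.sum_neg_distrib, mul_neg]

theorem oddPrimitive_succ {K : Type*} [Field K] (n : ℕ) (w z : K) :
    oddPrimitive (n + 1) w z = w ^ 2 * oddPrimitive n w z + w * z ^ (2 * n + 1) / (2 * n + 1) := by
  have hshift : ∀ j ∈ Finset.range n, z ^ (2 * j + 1) / (2 * j + 1) * (w ^ 2) ^ (n + 1 - 1 - j) =
      w ^ 2 * (z ^ (2 * j + 1) / (2 * j + 1) * (w ^ 2) ^ (n - 1 - j)) := fun j hj => by
    have hj := Finset.mem_range.1 hj
    rw [show n + 1 - 1 - j = n - 1 - j + 1 by omega, pow_succ]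
    ring
  rw [oddPrimitive, Finset.sum_range_succ, Finset.sum_congr rfl hshift, ← Finset.mul_sum,
    oddPrimitive, Nat.add_sub_cancel, Nat.sub_self]
  ring

theorem hasDerivAt_oddPrimitive {𝕜 : Type*} [NontriviallyNormedField 𝕜] [CharZero 𝕜] (n : ℕ)
    (w z : 𝕜) : HasDerivAt (oddPrimitive n w)
      (w * ∑ j ∈ Finset.range n, (z ^ 2) ^ j * (w ^ 2) ^ (n - 1 - j)) z := by
  refine (HasDerivAt.fun_sum (A' := fun j => (z ^ 2) ^ j * (w ^ 2) ^ (n - 1 - j))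
    fun j _ => ?_).const_mul w
  have hj : (2 * j + 1 : 𝕜) ≠ 0 := by norm_cast
  refine (((hasDerivAt_pow (2 * j + 1) z).div_const _).mul_const _).congr_deriv ?_
  push_cast
  rw [mul_div_cancel_left₀ _ hj, pow_mul]

theorem sum_pow_mul_sq_sub_sq {K : Type*} [CommRing K] (n : ℕ) (w z : K) :
    (w * ∑ j ∈ Finset.range n, (z ^ 2) ^ j * (w ^ 2) ^ (n - 1 - j)) * (w ^ 2 - z ^ 2) =
      w * (w ^ (2 * n) - z ^ (2 * n)) := by
  have h := (Commute.all (z ^ 2) (w ^ 2)).geom_sum₂_mul n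
  rw [← pow_mul, ← pow_mul] at h
  linear_combination -w * h

/-- The coefficients of the convolution sequence `c̃`, namely `c̃_{-m} = convCoeff (-m)` for
`0 ≤ m ≤ M`. They arise as second differences,
`8 / ((2m-3)(2m-1)(2m+1)) = 1/(2m-3) - 2/(2m-1) + 1/(2m+1)`. -/
noncomputable def convCoeff {K : Type*} [Field K] (m : K) : K :=
  1 / ((2 * m - 3) * (2 * m - 1) * (2 * m + 1))

theorem sum_convCoeff_succ {K : Type*} [Field K] (n : ℕ) (w : K) :
    ∑ l ∈ Finset.range (n + 1 + 1), convCoeff ((l : K) - (n + 1 : ℕ)) * w ^ (2 * l) =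
      w ^ 2 * (∑ l ∈ Finset.range (n + 1), convCoeff ((l : K) - n) * w ^ (2 * l)) -
        1 / ((2 * n + 1) * (2 * n + 3) * (2 * n + 5)) := by
  have hfirst : convCoeff ((0 : K) - (n + 1)) =
      -(1 / ((2 * n + 1) * (2 * n + 3) * (2 * n + 5))) := by
    rw [convCoeff, ← div_neg]
    ring_nf
  rw [Finset.sum_range_succ', Finset.mul_sum]
  push_cast
  rw [hfirst, pow_zero, mul_one, ← sub_eq_add_neg]
  congr 1
  refine Finset.sum_congr rfl fun l _ => ?_
  rw [add_sub_add_right_eq_sub]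
  ring

theorem sq_sub_one_mul_oddPrimitive_succ_sub {K : Type*} [Field K] [CharZero K] (n : ℕ) (w : K) :
    (w ^ 2 - 1) * (oddPrimitive (n + 1) w 1 - oddPrimitive n w 1) =
      w * (2 / ((2 * n + 1) * (2 * n + 3)) -
        8 * ∑ l ∈ Finset.range (n + 1), convCoeff ((l : K) - n) * w ^ (2 * l) +
        (w ^ 2 + 1) * w ^ (2 * n)) := by
  induction n with
  | zero =>
    rw [oddPrimitive, oddPrimitive, zero_add, Finset.sum_range_one, Finset.sum_range_one,
      Finset.sum_range_zero, convCoeff]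
    norm_num
    ring
  | succ n ih =>
    have hpole : (1 : K) / ((2 * n + 1) * (2 * n + 3)) =
        1 / ((2 * (n + 1 : ℕ) + 1) * (2 * (n + 1 : ℕ) + 3)) +
          4 * (1 / ((2 * n + 1) * (2 * n + 3) * (2 * n + 5))) := by
      have h1 : (2 * n + 1 : K) ≠ 0 := by norm_cast
      have h3 : (2 * n + 3 : K) ≠ 0 := by norm_cast
      have h5 : (2 * n + 5 : K) ≠ 0 := by norm_cast
      push_cast
      rw [show 2 * (n + 1 : K) + 1 = 2 * n + 3 by ring,
        show 2 * (n + 1 : K) + 3 = 2 * n + 5 by ring]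
      field_simp
      ring
    have hlast : (1 : K) / (2 * (n + 1 : ℕ) + 1) - 1 / (2 * n + 1) =
        -2 * (1 / ((2 * n + 1) * (2 * n + 3))) := by
      have h1 : (2 * n + 1 : K) ≠ 0 := by norm_cast
      have h3 : (2 * n + 3 : K) ≠ 0 := by norm_cast
      push_cast
      rw [show 2 * (n + 1 : K) + 1 = 2 * n + 3 by ring]
      field_simp
      ring
    rw [oddPrimitive_succ (n + 1), oddPrimitive_succ n]
    rw [oddPrimitive_succ n] at ih
    simp only [one_pow, sum_convCoeff_succ] at ih ⊢
    linear_combination w ^ 2 * ih + (w ^ 2 - 1) * w * hlast + 2 * w * hpole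

theorem two_mul_exp_mul_cos (x : ℂ) : 2 * exp (I * x) * Complex.cos x = exp (I * x) ^ 2 + 1 := by
  have hinv : exp (x * I) * exp (-x * I) = 1 := by
    rw [← exp_add, neg_mul, add_neg_cancel, exp_zero]
  rw [mul_right_comm, Complex.two_cos, mul_comm I]
  linear_combination hinv

theorem two_I_mul_sin_mul_oddPrimitive_succ_sub (n : ℕ) (x : ℂ) :
    2 * I * Complex.sin x *
        (oddPrimitive (n + 1) (exp (I * x)) 1 - oddPrimitive n (exp (I * x)) 1) =
      2 / ((2 * n + 1) * (2 * n + 3)) -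
        8 * ∑ l ∈ Finset.range (n + 1), convCoeff ((l : ℂ) - n) * exp (I * x) ^ (2 * l) +
        2 * Complex.cos x * exp (I * x) ^ (2 * n + 1) := by
  refine mul_left_cancel₀ (exp_ne_zero (I * x)) ?_
  linear_combination sq_sub_one_mul_oddPrimitive_succ_sub n (exp (I * x)) +
    (oddPrimitive (n + 1) (exp (I * x)) 1 - oddPrimitive n (exp (I * x)) 1) *
      two_I_mul_exp_mul_sin x - exp (I * x) ^ (2 * n + 1) * two_mul_exp_mul_cos x

theorem hasDerivAt_oddPrimitive_exp (n : ℕ) (w : ℂ) (t : ℝ) :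
    HasDerivAt (fun t : ℝ => oddPrimitive n w (exp (I * t)))
      (w * (∑ j ∈ Finset.range n, (exp (I * t) ^ 2) ^ j * (w ^ 2) ^ (n - 1 - j)) *
        (exp (I * t) * I)) t := by
  have hexp : HasDerivAt (fun t : ℝ => exp (I * t)) (exp (I * t) * I) t := by
    simpa only [id_eq, ofReal_one, mul_one] using
      ((hasDerivAt_id t).ofReal_comp.const_mul I).cexp
  exact (hasDerivAt_oddPrimitive n w _).comp t hexp

theorem sum_exp_mul_sin_sub (n : ℕ) (x y : ℂ) :
    (exp (I * x) * (∑ j ∈ Finset.range n, (exp (I * y) ^ 2) ^ j * (exp (I * x) ^ 2) ^ (n - 1 - j)) -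
      exp (I * x) * (∑ j ∈ Finset.range (n + 1),
        (exp (I * y) ^ 2) ^ j * (exp (I * x) ^ 2) ^ (n - j))) *
        exp (I * y) * Complex.sin (x - y) =
      exp (I * y) ^ (2 * n + 1) * Complex.sin y - exp (I * x) ^ (2 * n + 1) * Complex.sin x := by
  have hsum := sum_pow_mul_sq_sub_sq n (exp (I * x)) (exp (I * y))
  have hsum_succ := sum_pow_mul_sq_sub_sq (n + 1) (exp (I * x)) (exp (I * y))
  rw [Nat.add_sub_cancel] at hsum_succ
  refine mul_left_cancel₀ (mul_ne_zero (mul_ne_zero two_ne_zero I_ne_zero) (exp_ne_zero (I * x))) ?_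
  set D := exp (I * x) *
    ∑ j ∈ Finset.range n, (exp (I * y) ^ 2) ^ j * (exp (I * x) ^ 2) ^ (n - 1 - j)
  set D_succ := exp (I * x) *
    ∑ j ∈ Finset.range (n + 1), (exp (I * y) ^ 2) ^ j * (exp (I * x) ^ 2) ^ (n - j)
  linear_combination (D - D_succ) * two_I_mul_exp_mul_exp_mul_sin_sub x y + hsum - hsum_succ -
    exp (I * x) * exp (I * y) ^ (2 * n) * two_I_mul_exp_mul_sin y +
    exp (I * x) * exp (I * x) ^ (2 * n) * two_I_mul_exp_mul_sin x

theorem hasFracLaplacianAt_one_inX_expMode_odd_oddPrimitive {L : ℝ} (hL : 0 < L) {s : ℝ}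
    (hs : s ∈ Set.Ioo 0 π) (n : ℕ) :
    HasFracLaplacianAt 1 (inX L (expMode (2 * n + 1))) (L * Real.cot s)
      (2 * (2 * n + 1) * Complex.sin s / (L * π) *
        (oddPrimitive (n + 1) (exp (I * s)) 1 - oddPrimitive n (exp (I * s)) 1 -
          I * exp (I * s) ^ (2 * n + 1) * Complex.sin s * Real.log (Real.cot (s / 2)))) := by
  set R : ℝ → ℂ := fun t => (2 * n + 1) * (oddPrimitive n (exp (I * s)) (exp (I * t)) -
    oddPrimitive (n + 1) (exp (I * s)) (exp (I * t))) with hR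
  have hmode (t : ℝ) : expMode (2 * n + 1) t = exp (I * t) ^ (2 * n + 1) := by
    exact_mod_cast expMode_natCast (2 * n + 1) t
  have hRderiv (t : ℝ) := ((hasDerivAt_oddPrimitive_exp n (exp (I * s)) t).sub
    (hasDerivAt_oddPrimitive_exp (n + 1) (exp (I * s)) t)).const_mul (2 * n + 1 : ℂ)
  have hRcont : Continuous R := continuous_iff_continuousAt.2 fun t => (hRderiv t).continuousAt
  convert hasFracLaplacianAt_one_inX_of_regularPart hL hs (C := 1)
    (fun t _ => hasDerivAt_expMode (2 * n + 1) t) (fun t _ => (norm_expMode _ t).le)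
    hRcont (fun t _ => hRderiv t) fun t _ => ?_ using 1
  · have hπ : exp (I * π) = -1 := by rw [mul_comm, exp_pi_mul_I]
    simp only [hR, hπ, ofReal_zero, mul_zero, exp_zero, oddPrimitive_neg, hmode]
    push_cast
    ring
  · rw [hmode, hmode]
    push_cast
    linear_combination I * (2 * n + 1) * sum_exp_mul_sin_sub n s t

theorem hasFracLaplacianAt_one_inX_expMode_odd {L : ℝ} (hL : 0 < L) {s : ℝ}
    (hs : s ∈ Set.Ioo 0 π) (n : ℕ) :
    HasFracLaplacianAt 1 (inX L (expMode (2 * n + 1))) (L * Real.cot s)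
      (2 * I / (L * π) * (-1 / (2 * n + 3) +
        4 * (2 * n + 1) * ∑ l ∈ Finset.range (n + 1), convCoeff ((l : ℂ) - n) * expMode (2 * l) s -
        ((Real.cos s + Real.sin s ^ 2 * Real.log (Real.cot (s / 2)) : ℝ) : ℂ) * (2 * n + 1) *
          expMode (2 * n + 1) s)) := by
  have hmode (l : ℕ) : expMode (2 * l) s = exp (I * s) ^ (2 * l) := by
    exact_mod_cast expMode_natCast (2 * l) s
  have hmode_odd : expMode (2 * n + 1) s = exp (I * s) ^ (2 * n + 1) := by
    exact_mod_cast expMode_natCast (2 * n + 1) s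
  have hconst : 2 / (2 * n + 3 : ℂ) = (2 * n + 1) * (2 / ((2 * n + 1) * (2 * n + 3))) := by
    have hn : (2 * n + 1 : ℂ) ≠ 0 := by norm_cast
    rw [← mul_div_assoc, mul_div_mul_left _ _ hn]
  convert hasFracLaplacianAt_one_inX_expMode_odd_oddPrimitive hL hs n using 1
  simp only [hmode, hmode_odd]
  push_cast
  linear_combination (I * (2 * n + 1) / (L * π)) * two_I_mul_sin_mul_oddPrimitive_succ_sub n s -
    I / (L * π) * hconst - (2 * (2 * n + 1) * Complex.sin s / (L * π) *
      (oddPrimitive (n + 1) (exp (I * s)) 1 - oddPrimitive n (exp (I * s)) 1)) * I_sq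

end OddModes

section DiscreteFourier

theorem periodize_periodic (P : ℕ) (f : ℤ → ℂ) : Function.Periodic (periodize P f) P := fun l => by
  rw [periodize, periodize, Int.add_emod_right]

theorem sum_exp_two_pi_mul_I_mul_div {P : ℕ} (hP : P ≠ 0) (j : ℤ) :
    ∑ p ∈ Finset.range P, exp (2 * π * I * j * p / P) = if (P : ℤ) ∣ j then (P : ℂ) else 0 := by
  have hroot := Complex.isPrimitiveRoot_exp P hP
  have hpow (p : ℕ) : exp (2 * π * I * j * p / P) = (exp (2 * π * I / P) ^ j) ^ p := by
    rw [← exp_int_mul, ← exp_nat_mul]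
    ring_nf
  simp only [hpow]
  split_ifs with hdvd
  · simp only [(hroot.zpow_eq_one_iff_dvd j).2 hdvd, one_pow, Finset.sum_const, Finset.card_range,
      nsmul_one]
  · rw [geom_sum_eq (mt (hroot.zpow_eq_one_iff_dvd j).1 hdvd), ← zpow_natCast, zpow_comm,
      zpow_natCast, hroot.pow_eq_one, one_zpow, sub_self, zero_div]

theorem sum_range_mul_ite_dvd_sub {R : Type*} [NonUnitalNonAssocSemiring R] {P : ℕ} (hP : P ≠ 0)
    {c : ℤ → R} (hc : Function.Periodic c P) (l : ℤ) (x : R) :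
    ∑ n ∈ Finset.range P, c n * (if (P : ℤ) ∣ l - n then x else 0) = c l * x := by
  have hPpos : (0 : ℤ) < P := by omega
  obtain ⟨r, hr⟩ := Int.eq_ofNat_of_zero_le (Int.emod_nonneg l hPpos.ne')
  have hrP : r < P := by
    have := Int.emod_lt_of_pos l hPpos
    omega
  have hcr : c r = c l := by
    rw [← hr, Int.emod_def, mul_comm, ← smul_eq_mul, hc.sub_zsmul_eq]
  have hdvd {n : ℕ} (hn : n < P) : (P : ℤ) ∣ l - n ↔ n = r := by
    rw [← Int.modEq_iff_dvd, Int.ModEq, hr, Int.emod_eq_of_lt (by omega) (by omega), Nat.cast_inj]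
  rw [Finset.sum_eq_single_of_mem r (Finset.mem_range.2 hrP) fun n hn hnr => ?_]
  · rw [if_pos ((hdvd hrP).2 rfl), hcr]
  · rw [if_neg (mt (hdvd (Finset.mem_range.1 hn)).1 hnr), mul_zero]

theorem inverse_dft {P : ℕ} (hP : P ≠ 0) {c : ℤ → ℂ} (hc : Function.Periodic c P) (l : ℤ) :
    1 / P * ∑ p ∈ Finset.range P, dft P c p * exp (2 * π * I * l * p / P) = c l := by
  have hP' : (P : ℂ) ≠ 0 := Nat.cast_ne_zero.2 hP
  have hterm (p : ℕ) : dft P c p * exp (2 * π * I * l * p / P) =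
      ∑ n ∈ Finset.range P, c n * exp (2 * π * I * (l - n : ℤ) * p / P) := by
    rw [dft, Finset.sum_mul]
    refine Finset.sum_congr rfl fun n _ => ?_
    rw [mul_assoc, ← exp_add]
    push_cast
    ring_nf
  simp only [hterm]
  rw [Finset.sum_comm]
  simp only [← Finset.mul_sum, sum_exp_two_pi_mul_I_mul_div hP]
  rw [sum_range_mul_ite_dvd_sub hP hc]
  field_simp

theorem cyclicConv_eq_inverse_dft_mul {P : ℕ} (hP : P ≠ 0) (b : ℤ → ℂ) {c : ℤ → ℂ}
    (hc : Function.Periodic c P) (l : ℤ) :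
    cyclicConv P b c l = 1 / P * ∑ p ∈ Finset.range P,
      dft P b p * dft P c p * exp (2 * π * I * l * p / P) := by
  have hterm (p : ℕ) : dft P b p * dft P c p * exp (2 * π * I * l * p / P) =
      ∑ n ∈ Finset.range P, b n * (dft P c p * exp (2 * π * I * (l - n : ℤ) * p / P)) := by
    rw [dft, mul_assoc, Finset.sum_mul]
    refine Finset.sum_congr rfl fun n _ => ?_
    rw [mul_assoc, mul_left_comm (exp _), ← exp_add]
    push_cast
    ring_nf
  simp only [hterm]
  rw [Finset.sum_comm, Finset.mul_sum, cyclicConv]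
  refine Finset.sum_congr rfl fun n _ => ?_
  rw [← inverse_dft hP hc, ← Finset.mul_sum, mul_left_comm]

end DiscreteFourier

section CyclicConvolution

theorem bTilde_of_le {M P : ℕ} (hP : M < P) (a : ℕ → ℂ) {n : ℕ} (hn : n ≤ M) :
    bTilde M P a n = (8 * n + 4) * a n := by
  have hmod : (n : ℤ) % P = n := Int.emod_eq_of_lt (by omega) (by omega)
  simp only [bTilde, periodize, hmod, Nat.cast_le, hn, if_true, Int.toNat_natCast, Int.cast_natCast]

theorem bTilde_of_lt {M P : ℕ} (a : ℕ → ℂ) {n : ℕ} (hn : M < n) (hnP : n < P) :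
    bTilde M P a n = 0 := by
  have hmod : (n : ℤ) % P = n := Int.emod_eq_of_lt (by omega) (by omega)
  simp only [bTilde, periodize, hmod, Nat.cast_le, hn.not_ge, if_false]

theorem cTilde_sub_of_le {M P : ℕ} (hP : 2 * M + 1 ≤ P) {l n : ℕ} (hn : n ≤ M) (hln : l ≤ n) :
    cTilde M P (l - n) = convCoeff ((l : ℂ) - n) := by
  rcases hln.eq_or_lt with rfl | hlt
  · norm_num [cTilde, periodize, convCoeff]
  · have hmod : ((l : ℤ) - n) % P = l - n + P := by
      rw [← Int.add_emod_right, Int.emod_eq_of_lt (by omega) (by omega)]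
    simp only [cTilde, periodize, hmod]
    rw [if_neg (by omega), if_neg (by omega), convCoeff]
    push_cast
    rw [add_sub_cancel_right]

theorem cTilde_sub_of_lt {M P : ℕ} (hP : 2 * M + 1 ≤ P) {l n : ℕ} (hl : l ≤ M) (hnl : n < l) :
    cTilde M P (l - n) = 0 := by
  have hmod : ((l : ℤ) - n) % P = l - n := Int.emod_eq_of_lt (by omega) (by omega)
  simp only [cTilde, periodize, hmod]
  rw [if_neg (by omega), if_pos (by omega)]

theorem cyclicConv_bTilde_cTilde {M P : ℕ} (hP : 2 * M + 1 ≤ P) (a : ℕ → ℂ) {l : ℕ} (hl : l ≤ M) :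
    cyclicConv P (bTilde M P a) (cTilde M P) l =
      ∑ n ∈ Finset.Icc l M, (8 * n + 4) * a n * convCoeff ((l : ℂ) - n) := by
  rw [cyclicConv]
  refine (Finset.sum_subset_zero_on_sdiff (fun n hn => ?_) (fun n hn => ?_) fun n hn => ?_).symm
  · simp only [Finset.mem_Icc, Finset.mem_range] at hn ⊢
    omega
  · simp only [Finset.mem_sdiff, Finset.mem_Icc, Finset.mem_range, not_and_or, not_le] at hn
    rcases hn with ⟨hnP, hnl | hMn⟩
    · rw [cTilde_sub_of_lt hP hl hnl, mul_zero]
    · rw [bTilde_of_lt a hMn hnP, zero_mul]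
  · obtain ⟨hln, hnM⟩ := Finset.mem_Icc.1 hn
    rw [bTilde_of_le (by omega) a hnM, cTilde_sub_of_le hP hnM hln]

theorem sum_cyclicConv_bTilde_cTilde_mul {M P : ℕ} (hP : 2 * M + 1 ≤ P) (a g : ℕ → ℂ) :
    ∑ l ∈ Finset.range (M + 1), cyclicConv P (bTilde M P a) (cTilde M P) l * g l =
      ∑ n ∈ Finset.range (M + 1),
        a n * (4 * (2 * n + 1) * ∑ l ∈ Finset.range (n + 1), convCoeff ((l : ℂ) - n) * g l) := by
  have hconv : ∀ l ∈ Finset.range (M + 1),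
      cyclicConv P (bTilde M P a) (cTilde M P) l * g l =
        ∑ n ∈ Finset.Icc l M, a n * (4 * (2 * n + 1) * (convCoeff ((l : ℂ) - n) * g l)) :=
    fun l hl => by
      rw [cyclicConv_bTilde_cTilde hP a (Finset.mem_range_succ_iff.1 hl), Finset.sum_mul]
      exact Finset.sum_congr rfl fun n _ => by ring
  simp only [Finset.sum_congr rfl hconv, Finset.mul_sum]
  refine Finset.sum_comm' fun l n => ?_
  simp only [Finset.mem_range, Finset.mem_Icc]
  omega

end CyclicConvolution

end HalfLaplacian

theorem mainTheorem2 (L : ℝ) (hL : 0 < L) (M : ℕ) (a : ℕ → ℂ) (s : ℝ)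
    (hs : s ∈ Set.Ioo 0 Real.pi) (P : ℕ) (hP : 2 * M + 1 ≤ P) :
    (∀ l ∈ Finset.range (M + 1),
      HalfLaplacian.HalfLaplacianSExists L (HalfLaplacian.expMode (2 * l + 1)) s) ∧
    (∑ l ∈ Finset.range (M + 1),
        a l * HalfLaplacian.halfLaplacianS L (HalfLaplacian.expMode (2 * l + 1)) s =
      -(2 * Complex.I / (L * Real.pi)) * ∑ l ∈ Finset.range (M + 1), a l / (2 * l + 3)
      + 2 * Complex.I / (L * Real.pi) *
          ∑ l ∈ Finset.range (M + 1),
            HalfLaplacian.cyclicConv P (HalfLaplacian.bTilde M P a) (HalfLaplacian.cTilde M P) l *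
              HalfLaplacian.expMode (2 * l) s
      - 2 * Complex.I / (L * Real.pi) *
          ((Real.cos s + Real.sin s ^ 2 * Real.log (Real.cot (s / 2)) : ℝ) : ℂ) *
          ∑ l ∈ Finset.range (M + 1),
            (2 * l + 1) * a l * HalfLaplacian.expMode (2 * l + 1) s) ∧
    (∀ l : ℤ,
      HalfLaplacian.cyclicConv P (HalfLaplacian.bTilde M P a) (HalfLaplacian.cTilde M P) l =
        1 / P * ∑ p ∈ Finset.range P,
          HalfLaplacian.dft P (HalfLaplacian.bTilde M P a) p *
            HalfLaplacian.dft P (HalfLaplacian.cTilde M P) p *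
            Complex.exp (2 * Real.pi * Complex.I * l * p / P)) := by
  have hval (n : ℕ) := HalfLaplacian.hasFracLaplacianAt_one_inX_expMode_odd hL hs n
  have hlap (n : ℕ) := (hval n).fracLaplacian_eq
  refine ⟨fun n _ => ?_, ?_, fun l => ?_⟩
  · rw [HalfLaplacian.HalfLaplacianSExists, HalfLaplacian.halfLaplacianS, hlap]
    exact hval n
  · rw [HalfLaplacian.sum_cyclicConv_bTilde_cTilde_mul hP a
      fun l => HalfLaplacian.expMode (2 * l) s]
    simp only [Finset.mul_sum (Finset.range (M + 1)), ← Finset.sum_add_distrib,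
      ← Finset.sum_sub_distrib, HalfLaplacian.halfLaplacianS, hlap]
    exact Finset.sum_congr rfl fun n _ => by ring
  · exact HalfLaplacian.cyclicConv_eq_inverse_dft_mul (by omega) _
      (HalfLaplacian.periodize_periodic P _) l
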